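/- Let $\mathcal M=(S,\{0,1\},(P^a)_{a},(r^a)_{a})$ be a Markov decision process with finite state space $S$, action set $\{0,1\}$, transition matrices $P^0,P^1$ and reward vectors $r^0,r^1\in\mathbb R^S$. For $\lambda\in\mathbb R$, the $\lambda$-penalized process $\mathcal M(\lambda)$ has rewards $r^a_s-\lambda a$. A policy is a map $\pi:S\to\{0,1\}$; a bias $b^\pi(\lambda)\in\mathbb R^S$ and the gain $g^\pi(\lambda)\in\mathbb R$ of $\pi$ in $\mathcal M(\lambda)$ solve $g+b_s=r^{\pi(s)}_s-\lambda\pi(s)+\sum_{s'}P^{\pi(s)}_{s,s'}b_{s'}$ for all $s$. The policy $\pi$ is Bellman optimal in $\mathcal M(\lambda)$ if moreover $g+b_s=\max_{a}\big(r^a_s-\lambda a+\sum_{s'}P^a_{s,s'}b_{s'}\big)$ for all $s$. The process is unichain if every policy induces a Markov chain with exactly one recurrent class. It is indexable if, whenever $\lambda<\lambda'$ and $\pi,\pi'$ are Bellman optimal in $\mathcal M(\lambda),\mathcal M(\lambda')$ respectively, every state activated by $\pi'$ (i.e. with $\pi'(s)=1$) is activated by $\pi$. A Whittle index of $s$ is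 a number $\lambda_s\in\mathbb R$ such that Bellman optimal policies of $\mathcal M(\lambda)$ activate $s$ for every $\lambda<\lambda_s$ and do not activate $s$ for every $\lambda>\lambda_s$. The optimal activation advantage is $\alpha^*_s(\lambda)=r^1_s-\lambda-r^0_s+\sum_{s'}(P^1_{s,s'}-P^0_{s,s'})\,b^{\pi}_{s'}(\lambda)$, where $\pi$ is any Bellman optimal policy of $\mathcal M(\lambda)$ (for a unichain process such a $\pi$ exists and the value depends neither on $\pi$ nor on the choice of the bias). **Theorem.** Suppose that $\mathcal M$ is unichain and indexable and that the Whittle indices of its states are pairwise distinct. Then there is $\delta>0$ such that every process $\widehat{\mathcal M}=(S,\{0,1\},(\hat P^a)_a,(\hat r^a)_a)$ with the same support as $\mathcal M$ (i.e. $\hat P^a_{s,s'}>0\iff P^a_{s,s'}>0$) and with $$\|\mathcal M-\widehat{\mathcal M}\|_\infty:=\max\Big\{\max_{a,s}\sum_{s'}|P^a_{s,s'}-\hat P^a_{s,s'}|,\ \max_{a,s}|r^a_s-\hat r^a_s|\Big\}\le\delta$$ is indexable (in particular this holds when $\hat r^a=r^a$). Moreover, for each state $s$ the optimal activation advantage $\hat\alpha^*_s$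 of $\widehat{\mathcal M}$ crosses zero exactly once: there is $\hat\lambda_s\in\mathbb R$, the Whittle index of $s$ in $\widehat{\mathcal M}$, with $\hat\alpha^*_s(\hat\lambda_s)=0$, $\hat\alpha^*_s(\lambda)>0$ for $\lambda<\hat\lambda_s$ and $\hat\alpha^*_s(\lambda)<0$ for $\lambda>\hat\lambda_s$. -/

import Mathlib

/-- A finite Markov decision process (restless arm) with state space `S` and action set `{0, 1}`:
`P a s s'` is the probability of moving from `s` to `s'` under action `a`, and `r a s` is the
reward of action `a` in state `s`. -/
structure ArmMDP (S : Type*) [Fintype S] where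
  P : Fin 2 → S → S → ℝ
  P_nonneg : ∀ a s s', 0 ≤ P a s s'
  P_sum : ∀ a s, ∑ s', P a s s' = 1
  r : Fin 2 → S → ℝ

/-- A recurrent class of a finite transition matrix: a nonempty set of states which the chain cannot
leave, and inside which every state can be reached from every other one. -/
def IsRecurrentClass {S : Type*} (Q : S → S → ℝ) (C : Set S) : Prop :=
  C.Nonempty ∧ (∀ x ∈ C, ∀ y, 0 < Q x y → y ∈ C) ∧
    ∀ x ∈ C, ∀ y ∈ C, Relation.ReflTransGen (fun u v => 0 < Q u v) x y

namespace ArmMDP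

variable {S : Type*} [Fintype S]

/-- The transition matrix induced by a policy `π : S → {0, 1}`. -/
def policyP (M : ArmMDP S) (π : S → Fin 2) (s s' : S) : ℝ := M.P (π s) s s'

/-- An MDP is unichain if every (stationary deterministic) policy induces a Markov chain with exactly
one recurrent class. -/
def IsUnichain (M : ArmMDP S) : Prop :=
  ∀ π : S → Fin 2, ∃! C : Set S, IsRecurrentClass (M.policyP π) C

/-- The reward `r^a_s - lam * a` of the `lam`-penalized MDP. -/
def penReward (M : ArmMDP S) (lam : ℝ) (a : Fin 2) (s : S) : ℝ :=
  M.r a s - lam * ((a : ℕ) : ℝ)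

/-- `g` and `b` are a gain and a bias of the policy `π` in the `lam`-penalized MDP: they solve
`g + b = r^π(lam) + P^π b`. -/
def IsGainBias (M : ArmMDP S) (lam : ℝ) (π : S → Fin 2) (g : ℝ) (b : S → ℝ) : Prop :=
  ∀ s, g + b s = M.penReward lam (π s) s + ∑ s', M.P (π s) s s' * b s'

/-- The policy `π` is Bellman optimal in the `lam`-penalized MDP: its gain and bias solve
`g + b_s = max_a (r^a_s(lam) + ∑ s', P^a_{s s'} b_{s'})`. -/
def IsBellmanOptimal (M : ArmMDP S) (lam : ℝ) (π : S → Fin 2) : Prop :=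
  ∃ (g : ℝ) (b : S → ℝ), M.IsGainBias lam π g b ∧
    ∀ s a, M.penReward lam a s + ∑ s', M.P a s s' * b s' ≤ g + b s

/-- A bias `b^π(lam)` of the policy `π` in the `lam`-penalized MDP. In a unichain MDP it exists and
is unique up to an additive constant. -/
noncomputable def bias (M : ArmMDP S) (lam : ℝ) (π : S → Fin 2) : S → ℝ :=
  Classical.epsilon fun b : S → ℝ => ∃ g : ℝ, M.IsGainBias lam π g b

/-- The activation advantage `α^π_s(lam) = r^1_s - lam - r^0_s + (P^1_s - P^0_s) · b^π(lam)`. Adding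
a constant to the bias does not change it. -/
noncomputable def activationAdvantage (M : ArmMDP S) (π : S → Fin 2) (s : S) (lam : ℝ) : ℝ :=
  M.r 1 s - lam - M.r 0 s + ∑ s', (M.P 1 s s' - M.P 0 s s') * M.bias lam π s'

/-- The optimal activation advantage `α*_s(lam)`: the activation advantage of `s` under a Bellman
optimal policy of the `lam`-penalized MDP. In a unichain MDP such a policy exists, and the value does
not depend on which one is taken. -/
noncomputable def optActivationAdvantage (M : ArmMDP S) (s : S) (lam : ℝ) : ℝ :=
  M.activationAdvantage (Classical.epsilon fun π : S → Fin 2 => M.IsBellmanOptimal lam π) s lam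

/-- Indexability: as the penalty increases, the set `{s | π s = 1}` of states activated by Bellman
optimal policies `π` can only shrink. -/
def IsIndexable (M : ArmMDP S) : Prop :=
  ∀ lam lam' : ℝ, lam < lam' → ∀ π π' : S → Fin 2,
    M.IsBellmanOptimal lam π → M.IsBellmanOptimal lam' π' → {s | π' s = 1} ⊆ {s | π s = 1}

/-- `x` is the Whittle index of the state `s`: Bellman optimal policies activate `s` when the penalty
is below `x`, and do not activate it when the penalty is above `x`. -/
def IsWhittleIndex (M : ArmMDP S) (s : S) (x : ℝ) : Prop :=
  ∀ (lam : ℝ) (π : S → Fin 2), M.IsBellmanOptimal lam π →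
    (lam < x → π s = 1) ∧ (x < lam → π s = 0)

/-- Two MDPs have the same support if the same transitions have positive probability. -/
def SameSupport (M N : ArmMDP S) : Prop :=
  ∀ a s s', 0 < M.P a s s' ↔ 0 < N.P a s s'

/-- The distance `‖M - N‖_∞`: the largest `ℓ¹` distance between corresponding rows of the transition
matrices, or the largest difference of rewards, whichever is larger. -/
noncomputable def supDist (M N : ArmMDP S) : ℝ :=
  max (⨆ a : Fin 2, ⨆ s : S, ∑ s', |M.P a s s' - N.P a s s'|)
    (⨆ a : Fin 2, ⨆ s : S, |M.r a s - N.r a s|)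

end ArmMDP

/-!
Fix a policy `π` of a unichain process. Two closed sets, of the same or of two different policies,
always meet; hence a function which is superharmonic for one policy and subharmonic for another is
constant (`HasCore.const_of_super_sub`), because its minimizers and its maximizers are closed. This
comparison principle makes `1 - P^π + J` invertible, gives the uniqueness of biases up to a constant
and the independence of the optimal advantage `α*` of the optimal policy, and, through policy
improvement, the existence of Bellman optimal policies. A policy is Bellman optimal if and only if
its advantages have the signs prescribed by its actions (`HasCore.isBellmanOptimal_iff`). The
advantage `α^π_s(lam)` is affine in `lam`, and continuous in the process and `lam` jointly.

At a penalty `lam`, if `α*_k(lam) = 0` in `M` then both actions are optimal in `k`, and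
indexability makes `lam` the Whittle index of `k`. Since the indices are distinct, at most one
advantage vanishes at `lam`. If none does, all signs persist for nearby processes and penalties. If
`α*_k(lam) = 0`, the signs in the other states persist, the two optimal policies of `M` at `lam`
differ in `k` only, and the advantage of `k` under the one leaving `k` passive has negative slope, by
indexability (`HasCore.advSlope_neg`). For a nearby process this remains true, so that near `lam` one
of the two policies is optimal and `α*_k` cannot return from `≤ 0` to `≥ 0`
(`HasCore.eventually_crossing`).

For penalties of large absolute value a constant policy is optimal, with advantages of slope exactly
`-1` in every process. Compactness of the remaining interval of penalties makes the neighbourhood of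
`M` uniform, and continuity of `α*` in the penalty then gives a unique zero (`exists_crossing`).
-/

open Filter Topology Matrix

namespace ArmMDP

variable {S : Type*} [Fintype S]

/-! ### Closed sets of policies -/

/-- The set `A` is closed under the chain of the policy `π`: the chain cannot leave it. -/
def IsClosedUnder (M : ArmMDP S) (π : S → Fin 2) (A : Set S) : Prop :=
  ∀ x ∈ A, ∀ y, 0 < M.P (π x) x y → y ∈ A

/-- Every policy has a state lying in all of its nonempty closed sets. This is the form in which the
unichain property is used; it depends on the transition matrices through their supports only. -/
def HasCore (M : ArmMDP S) : Prop :=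
  ∀ π : S → Fin 2, ∃ s₀ : S, ∀ A : Set S, A.Nonempty → M.IsClosedUnder π A → s₀ ∈ A

/-- A minimal nonempty closed subset is a recurrent class. -/
theorem exists_isRecurrentClass_subset (Q : S → S → ℝ) {A : Set S} (hA : A.Nonempty)
    (hcl : ∀ x ∈ A, ∀ y, 0 < Q x y → y ∈ A) : ∃ C ⊆ A, IsRecurrentClass Q C := by
  obtain ⟨C, hC⟩ := (Set.toFinite
    {B : Set S | B ⊆ A ∧ B.Nonempty ∧ ∀ x ∈ B, ∀ y, 0 < Q x y → y ∈ B}).exists_minimal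
    ⟨A, subset_rfl, hA, hcl⟩
  obtain ⟨hCA, hne, hC'⟩ := hC.prop
  refine ⟨C, hCA, hne, hC', fun x hx y hy => ?_⟩
  have hsub : {z | Relation.ReflTransGen (fun u v => 0 < Q u v) x z} ⊆ C := by
    intro z hz
    induction hz with
    | refl => exact hx
    | tail _ h ih => exact hC' _ ih _ h
  exact hC.le_of_le ⟨hsub.trans hCA, ⟨x, Relation.ReflTransGen.refl⟩,
    fun u hu v huv => Relation.ReflTransGen.tail hu huv⟩ hsub hy

theorem IsUnichain.hasCore {M : ArmMDP S} (hM : M.IsUnichain) : M.HasCore := by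
  intro π
  obtain ⟨C, hC, huniq⟩ := hM π
  obtain ⟨x, hx⟩ := hC.1
  refine ⟨x, fun A hA hcl => ?_⟩
  obtain ⟨D, hDA, hD⟩ := exists_isRecurrentClass_subset (M.policyP π) hA hcl
  exact hDA (huniq D hD ▸ hx)

theorem HasCore.of_sameSupport {M N : ArmMDP S} (hM : M.HasCore) (h : M.SameSupport N) :
    N.HasCore := by
  intro π
  obtain ⟨s₀, hs₀⟩ := hM π
  exact ⟨s₀, fun A hA hcl => hs₀ A hA fun x hx y hy => hcl x hx y ((h _ _ _).1 hy)⟩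

theorem HasCore.nonempty {M : ArmMDP S} (hM : M.HasCore) : Nonempty S :=
  ⟨(hM fun _ => 0).choose⟩

/-- Closed sets of two different policies meet: otherwise the policy that follows the first one on
the first set and the second one elsewhere would have two disjoint closed sets. -/
theorem HasCore.inter_nonempty {M : ArmMDP S} (hM : M.HasCore) {π π' : S → Fin 2} {A B : Set S}
    (hA : A.Nonempty) (hB : B.Nonempty) (hπ : M.IsClosedUnder π A) (hπ' : M.IsClosedUnder π' B) :
    (A ∩ B).Nonempty := by
  classical
  by_contra hAB
  have hdisj : ∀ x ∈ B, x ∉ A := fun x hx hx' => hAB ⟨x, hx', hx⟩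
  obtain ⟨s₀, hs₀⟩ := hM fun s => if s ∈ A then π s else π' s
  refine hAB ⟨s₀, hs₀ A hA fun x hx y hy => hπ x hx y ?_, hs₀ B hB fun x hx y hy => hπ' x hx y ?_⟩
  · simpa [hx] using hy
  · simpa [hdisj x hx] using hy

/-! ### A comparison principle -/

theorem mul_le_sum_of_forall_le (M : ArmMDP S) (a : Fin 2) (s : S) {d : S → ℝ} {m : ℝ}
    (h : ∀ x, m ≤ d x) : m ≤ ∑ s', M.P a s s' * d s' := by
  calc m = ∑ s', M.P a s s' * m := by rw [← Finset.sum_mul, M.P_sum, one_mul]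
    _ ≤ _ := Finset.sum_le_sum fun s' _ => mul_le_mul_of_nonneg_left (h s') (M.P_nonneg _ _ _)

/-- If the average of `d` over a row is at most its minimum, then the row only reaches minimizers. -/
theorem eq_of_sum_le_of_forall_le (M : ArmMDP S) {a : Fin 2} {s : S} {d : S → ℝ} {m : ℝ}
    (h : ∀ x, m ≤ d x) (hs : ∑ s', M.P a s s' * d s' ≤ m) {y : S} (hy : 0 < M.P a s y) :
    d y = m := by
  have h0 : ∑ s', M.P a s s' * (d s' - m) ≤ 0 := by
    simp only [mul_sub, Finset.sum_sub_distrib]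
    rw [← Finset.sum_mul, M.P_sum, one_mul]
    linarith
  have hnn : ∀ s' ∈ Finset.univ, 0 ≤ M.P a s s' * (d s' - m) := fun s' _ =>
    mul_nonneg (M.P_nonneg _ _ _) (sub_nonneg.2 (h s'))
  have h1 := (Finset.sum_eq_zero_iff_of_nonneg hnn).1 (le_antisymm h0 (Finset.sum_nonneg hnn)) y
    (Finset.mem_univ y)
  rcases mul_eq_zero.1 h1 with h2 | h2 <;> linarith

theorem nonneg_of_superharmonic [Nonempty S] (M : ArmMDP S) {π : S → Fin 2} {c : ℝ} {d : S → ℝ}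
    (h : ∀ s, ∑ s', M.P (π s) s s' * d s' ≤ c + d s) : 0 ≤ c := by
  obtain ⟨x, hx⟩ := Finite.exists_min d
  have := h x
  have := M.mul_le_sum_of_forall_le (π x) x hx
  linarith

theorem isClosedUnder_minimizers (M : ArmMDP S) {π : S → Fin 2} {d : S → ℝ} {m : ℝ}
    (hm : ∀ x, m ≤ d x) (h : ∀ s, ∑ s', M.P (π s) s s' * d s' ≤ d s) :
    M.IsClosedUnder π {x | d x = m} := fun x hx _ hy =>
  M.eq_of_sum_le_of_forall_le hm ((h x).trans_eq hx) hy

/-- A function which is superharmonic for one policy and subharmonic for another one, up to the same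
additive constant `c`, is constant, and `c = 0`: its minimizers and its maximizers form closed
sets of the two policies, and these meet. -/
theorem HasCore.const_of_super_sub {M : ArmMDP S} (hM : M.HasCore) {π π' : S → Fin 2} {c : ℝ}
    {d : S → ℝ} (h : ∀ s, ∑ s', M.P (π s) s s' * d s' ≤ c + d s)
    (h' : ∀ s, c + d s ≤ ∑ s', M.P (π' s) s s' * d s') : c = 0 ∧ ∃ m, ∀ s, d s = m := by
  have := hM.nonempty
  have h'' : ∀ s, ∑ s', M.P (π' s) s s' * -d s' ≤ -c + -d s := fun s => by
    simp only [mul_neg, Finset.sum_neg_distrib]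
    linarith [h' s]
  have hc : c = 0 := by
    have h1 := M.nonneg_of_superharmonic h
    have h2 := M.nonneg_of_superharmonic (d := fun s => -d s) h''
    linarith
  subst hc
  obtain ⟨x, hx⟩ := Finite.exists_min d
  obtain ⟨y, hy⟩ := Finite.exists_max d
  have hA := M.isClosedUnder_minimizers (m := d x) hx (by simpa using h)
  have hB := M.isClosedUnder_minimizers (d := fun s => -d s) (m := -d y)
    (fun z => neg_le_neg (hy z)) (by simpa using h'')
  obtain ⟨z, hz, hz'⟩ := hM.inter_nonempty (A := {z | d z = d x}) (B := {z | -d z = -d y}) ⟨x, rfl⟩ ⟨y, rfl⟩ hA hB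
  refine ⟨rfl, d x, fun s => le_antisymm ?_ (hx s)⟩
  have h1 : d z = d x := hz
  have h2 : -d z = -d y := hz'
  linarith [hy s]

/-! ### Gains and biases -/

theorem sum_sub_mul_const (M : ArmMDP S) (s : S) (m : ℝ) :
    ∑ s', (M.P 1 s s' - M.P 0 s s') * m = 0 := by
  rw [← Finset.sum_mul, Finset.sum_sub_distrib, M.P_sum, M.P_sum]
  simp

theorem sum_eq_of_const_sub (M : ArmMDP S) (s : S) {b b' : S → ℝ} {m : ℝ}
    (h : ∀ x, b' x - b x = m) :
    ∑ s', (M.P 1 s s' - M.P 0 s s') * b' s' = ∑ s', (M.P 1 s s' - M.P 0 s s') * b s' := by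
  have h1 := M.sum_sub_mul_const s m
  rw [← sub_eq_zero, ← Finset.sum_sub_distrib, ← h1]
  refine Finset.sum_congr rfl fun x _ => ?_
  rw [← h x]
  ring

/-- Two gain-bias pairs of `π` have the same gain, and their biases differ by a constant. -/
theorem HasCore.isGainBias_unique {M : ArmMDP S} (hM : M.HasCore) {lam : ℝ} {π : S → Fin 2}
    {g g' : ℝ} {b b' : S → ℝ} (h : M.IsGainBias lam π g b) (h' : M.IsGainBias lam π g' b') :
    g' - g = 0 ∧ ∃ m, ∀ s, b' s - b s = m := by
  have key : ∀ s, ∑ s', M.P (π s) s s' * (b' s' - b s') = (g' - g) + (b' s - b s) := fun s => by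
    simp only [mul_sub, Finset.sum_sub_distrib]
    linarith [h s, h' s]
  exact hM.const_of_super_sub (π := π) (π' := π) (d := fun s => b' s - b s)
    (fun s => (key s).le) (fun s => (key s).ge)

/-- The value of playing `a` once in `s`, relative to a gain-bias pair of `π`. -/
theorem IsGainBias.actionValue_eq {M : ArmMDP S} {lam : ℝ} {π : S → Fin 2} {g : ℝ} {b : S → ℝ}
    (h : M.IsGainBias lam π g b) (s : S) (a : Fin 2) :
    M.penReward lam a s + ∑ s', M.P a s s' * b s' = g + b s + (((a : ℕ) : ℝ) - ((π s : ℕ) : ℝ)) *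
      (M.r 1 s - lam - M.r 0 s + ∑ s', (M.P 1 s s' - M.P 0 s s') * b s') := by
  have hs := h s
  simp only [sub_mul (M.P 1 s _), Finset.sum_sub_distrib]
  generalize π s = c at *
  fin_cases a <;> fin_cases c <;> simp [penReward] at hs ⊢ <;> linarith

/-- The sign condition on an advantage `x` under which the action `a` is a best choice. -/
def GoodSign (a : Fin 2) (x : ℝ) : Prop := (a = 1 → 0 ≤ x) ∧ (a = 0 → x ≤ 0)

theorem IsGainBias.goodSign_iff {M : ArmMDP S} {lam : ℝ} {π : S → Fin 2} {g : ℝ} {b : S → ℝ}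
    (h : M.IsGainBias lam π g b) (s : S) :
    GoodSign (π s) (M.r 1 s - lam - M.r 0 s + ∑ s', (M.P 1 s s' - M.P 0 s s') * b s') ↔
      ∀ a, M.penReward lam a s + ∑ s', M.P a s s' * b s' ≤ g + b s := by
  simp only [h.actionValue_eq s, Fin.forall_fin_two, GoodSign]
  generalize M.r 1 s - lam - M.r 0 s + ∑ s', (M.P 1 s s' - M.P 0 s s') * b s' = x
  generalize π s = c
  fin_cases c <;> simp

/-! ### A canonical bias -/

section Solution

variable [DecidableEq S]

/-- The matrix `1 - P^π + J`, where `J` has all entries `1`. It is invertible in a unichain MDP. -/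
def poissonMatrix (M : ArmMDP S) (π : S → Fin 2) : Matrix S S ℝ :=
  Matrix.of fun s s' => (if s = s' then 1 else 0) - M.P (π s) s s' + 1

theorem poissonMatrix_mulVec (M : ArmMDP S) (π : S → Fin 2) (b : S → ℝ) (s : S) :
    (M.poissonMatrix π *ᵥ b) s = b s - ∑ s', M.P (π s) s s' * b s' + ∑ s', b s' := by
  simp [poissonMatrix, Matrix.mulVec, dotProduct, add_mul, sub_mul, Finset.sum_add_distrib]

theorem HasCore.isUnit_det {M : ArmMDP S} (hM : M.HasCore) (π : S → Fin 2) :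
    IsUnit (M.poissonMatrix π).det := by
  have := hM.nonempty
  rw [← Matrix.isUnit_iff_isUnit_det, ← Matrix.mulVec_injective_iff_isUnit]
  intro b b' hbb
  have hz : ∀ s, (b - b') s - ∑ s', M.P (π s) s s' * (b - b') s' + ∑ s', (b - b') s' = 0 := by
    intro s
    have h0 : M.poissonMatrix π *ᵥ (b - b') = 0 := by
      rw [Matrix.mulVec_sub]
      exact sub_eq_zero.2 hbb
    rw [← poissonMatrix_mulVec, h0, Pi.zero_apply]
  obtain ⟨hc, m, hm⟩ := hM.const_of_super_sub (π := π) (π' := π) (d := b - b')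
    (c := ∑ s', (b - b') s') (fun s => by linarith [hz s]) (fun s => by linarith [hz s])
  have hm0 : m = 0 := by
    rw [Finset.sum_congr rfl fun s _ => hm s] at hc
    simpa using hc
  ext s
  have := hm s
  rw [hm0, Pi.sub_apply] at this
  linarith

/-- The bias of `π` in the `lam`-penalized MDP, normalized so that its entries add up to the gain. -/
noncomputable def normBias (M : ArmMDP S) (lam : ℝ) (π : S → Fin 2) : S → ℝ :=
  (M.poissonMatrix π)⁻¹ *ᵥ fun s => M.penReward lam (π s) s

theorem HasCore.isGainBias_normBias {M : ArmMDP S} (hM : M.HasCore) (lam : ℝ) (π : S → Fin 2) :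
    M.IsGainBias lam π (∑ s, M.normBias lam π s) (M.normBias lam π) := by
  intro s
  have h : M.poissonMatrix π *ᵥ M.normBias lam π = fun s => M.penReward lam (π s) s := by
    rw [normBias, Matrix.mulVec_mulVec, Matrix.mul_nonsing_inv _ (hM.isUnit_det π),
      Matrix.one_mulVec]
  have hs := congrFun h s
  rw [poissonMatrix_mulVec] at hs
  linarith

/-- The activation advantage computed from the normalized bias. -/
noncomputable def adv (M : ArmMDP S) (π : S → Fin 2) (s : S) (lam : ℝ) : ℝ :=
  M.r 1 s - lam - M.r 0 s + ∑ s', (M.P 1 s s' - M.P 0 s s') * M.normBias lam π s'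

/-- The slope of the affine function `lam ↦ α^π_s(lam)`. -/
noncomputable def advSlope (M : ArmMDP S) (π : S → Fin 2) (s : S) : ℝ :=
  -1 - ∑ s', (M.P 1 s s' - M.P 0 s s') *
    ((M.poissonMatrix π)⁻¹ *ᵥ fun x => ((π x : ℕ) : ℝ)) s'

theorem adv_eq (M : ArmMDP S) (π : S → Fin 2) (s : S) (lam mu : ℝ) :
    M.adv π s mu = M.adv π s lam + (mu - lam) * M.advSlope π s := by
  have hb : M.normBias mu π = M.normBias lam π -
      (mu - lam) • ((M.poissonMatrix π)⁻¹ *ᵥ fun x => ((π x : ℕ) : ℝ)) := by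
    rw [normBias, normBias, ← Matrix.mulVec_smul, ← Matrix.mulVec_sub]
    congr 1
    ext x
    simp only [penReward, Pi.sub_apply, Pi.smul_apply, smul_eq_mul]
    ring
  rw [adv, adv, advSlope, hb]
  simp only [Pi.sub_apply, Pi.smul_apply, smul_eq_mul, mul_sub, Finset.sum_sub_distrib,
    Finset.mul_sum]
  rw [Finset.sum_congr rfl fun s' _ => mul_left_comm _ (mu - lam) _]
  simp only [← Finset.mul_sum]
  ring

/-- For a policy playing the same action everywhere, the penalty shifts the gain and leaves the bias
unchanged. -/
theorem HasCore.advSlope_const {M : ArmMDP S} (hM : M.HasCore) (a : Fin 2) (s : S) :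
    M.advSlope (fun _ => a) s = -1 := by
  have := hM.nonempty
  have h : M.poissonMatrix (fun _ => a) *ᵥ (fun _ => ((a : ℕ) : ℝ) / Fintype.card S) =
      fun _ => ((a : ℕ) : ℝ) := by
    ext x
    rw [poissonMatrix_mulVec, ← Finset.sum_mul, M.P_sum]
    simp
    field_simp
  have h2 : (M.poissonMatrix (fun _ => a))⁻¹ *ᵥ (fun _ => ((a : ℕ) : ℝ)) =
      fun _ => ((a : ℕ) : ℝ) / Fintype.card S := by
    rw [← h, Matrix.mulVec_mulVec, Matrix.nonsing_inv_mul _ (hM.isUnit_det _), Matrix.one_mulVec]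
  rw [advSlope, h2, sum_sub_mul_const, sub_zero]

theorem HasCore.activationAdvantage_eq {M : ArmMDP S} (hM : M.HasCore) (π : S → Fin 2) (s : S)
    (lam : ℝ) : M.activationAdvantage π s lam = M.adv π s lam := by
  obtain ⟨g, hg⟩ : ∃ g, M.IsGainBias lam π g (M.bias lam π) :=
    Classical.epsilon_spec (p := fun b : S → ℝ => ∃ g : ℝ, M.IsGainBias lam π g b)
      ⟨_, _, hM.isGainBias_normBias lam π⟩
  obtain ⟨-, m, hm⟩ := hM.isGainBias_unique (hM.isGainBias_normBias lam π) hg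
  rw [activationAdvantage, adv, M.sum_eq_of_const_sub s hm]

/-! ### Bellman optimality and signs of advantages -/

theorem HasCore.isBellmanOptimal_iff {M : ArmMDP S} (hM : M.HasCore) {lam : ℝ} {π : S → Fin 2} :
    M.IsBellmanOptimal lam π ↔ ∀ s, GoodSign (π s) (M.adv π s lam) := by
  constructor
  · rintro ⟨g, b, h, hmax⟩ s
    obtain ⟨-, m, hm⟩ := hM.isGainBias_unique h (hM.isGainBias_normBias lam π)
    rw [adv, M.sum_eq_of_const_sub s hm]
    exact (h.goodSign_iff s).2 (hmax s)
  · intro h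
    have hb := hM.isGainBias_normBias lam π
    exact ⟨_, _, hb, fun s => (hb.goodSign_iff s).1 (h s)⟩

/-- All Bellman optimal policies have the same activation advantages. -/
theorem HasCore.adv_eq_of_isBellmanOptimal {M : ArmMDP S} (hM : M.HasCore) {lam : ℝ}
    {π π' : S → Fin 2} (h : M.IsBellmanOptimal lam π) (h' : M.IsBellmanOptimal lam π') (s : S) :
    M.adv π s lam = M.adv π' s lam := by
  have hb := hM.isGainBias_normBias lam π
  have hb' := hM.isGainBias_normBias lam π'
  have hm := fun s => (hb.goodSign_iff s).1 (hM.isBellmanOptimal_iff.1 h s)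
  have hm' := fun s => (hb'.goodSign_iff s).1 (hM.isBellmanOptimal_iff.1 h' s)
  obtain ⟨-, m, hm⟩ := hM.const_of_super_sub (π := π) (π' := π')
    (d := fun s => M.normBias lam π' s - M.normBias lam π s)
    (c := ∑ s, M.normBias lam π' s - ∑ s, M.normBias lam π s)
    (fun s => by
      simp only [mul_sub, Finset.sum_sub_distrib]
      linarith [hb s, hm' s (π s)])
    (fun s => by
      simp only [mul_sub, Finset.sum_sub_distrib]
      linarith [hb' s, hm s (π' s)])
  rw [adv, adv, M.sum_eq_of_const_sub s hm]

/-- Changing the action in a state of zero advantage preserves Bellman optimality. -/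
theorem HasCore.isBellmanOptimal_update {M : ArmMDP S} (hM : M.HasCore) {lam : ℝ}
    {π : S → Fin 2} (h : M.IsBellmanOptimal lam π) {k : S} (hk : M.adv π k lam = 0) (a : Fin 2) :
    M.IsBellmanOptimal lam (Function.update π k a) := by
  have hb := hM.isGainBias_normBias lam π
  have hmax := fun s => (hb.goodSign_iff s).1 (hM.isBellmanOptimal_iff.1 h s)
  refine ⟨_, _, fun s => ?_, hmax⟩
  rcases eq_or_ne s k with rfl | hs
  · rw [Function.update_self, hb.actionValue_eq s a, ← adv, hk, mul_zero, add_zero]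
  · rw [Function.update_of_ne hs]
    exact hb s

/-- If activating `k` is an improvement when `k` is passive, then it is still advantageous once `k`
is active. -/
theorem HasCore.adv_update_one_pos {M : ArmMDP S} (hM : M.HasCore) {lam : ℝ} {π : S → Fin 2}
    {k : S} (h : 0 < M.adv (Function.update π k 0) k lam) :
    0 < M.adv (Function.update π k 1) k lam := by
  by_contra! h1
  have hb₀ := hM.isGainBias_normBias lam (Function.update π k 0)
  have hb₁ := hM.isGainBias_normBias lam (Function.update π k 1)
  set σ₀ := Function.update π k 0
  set σ₁ := Function.update π k 1
  have hk₀ : σ₀ k = 0 := by simp [σ₀]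
  have hk₁ : σ₁ k = 1 := by simp [σ₁]
  have hne : ∀ s, s ≠ k → σ₀ s = σ₁ s := fun s hs => by simp [σ₀, σ₁, hs]
  have e₁ : ∀ s, ∑ s, M.normBias lam σ₀ s + M.normBias lam σ₀ s ≤
      M.penReward lam (σ₁ s) s + ∑ s', M.P (σ₁ s) s s' * M.normBias lam σ₀ s' := fun s => by
    rw [hb₀.actionValue_eq s, ← adv]
    rcases eq_or_ne s k with rfl | hs
    · rw [hk₀, hk₁]
      simpa using h.le
    · simp [hne s hs]
  have e₀ : ∀ s, ∑ s, M.normBias lam σ₁ s + M.normBias lam σ₁ s ≤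
      M.penReward lam (σ₀ s) s + ∑ s', M.P (σ₀ s) s s' * M.normBias lam σ₁ s' := fun s => by
    rw [hb₁.actionValue_eq s, ← adv]
    rcases eq_or_ne s k with rfl | hs
    · rw [hk₀, hk₁]
      simpa using h1
    · simp [hne s hs]
  obtain ⟨-, m, hm⟩ := hM.const_of_super_sub (π := σ₁) (π' := σ₀)
    (d := fun s => M.normBias lam σ₁ s - M.normBias lam σ₀ s)
    (c := ∑ s, M.normBias lam σ₁ s - ∑ s, M.normBias lam σ₀ s)
    (fun s => by
      simp only [mul_sub, Finset.sum_sub_distrib]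
      linarith [e₁ s, hb₁ s])
    (fun s => by
      simp only [mul_sub, Finset.sum_sub_distrib]
      linarith [e₀ s, hb₀ s])
  have : M.adv σ₁ k lam = M.adv σ₀ k lam := by rw [adv, adv, M.sum_eq_of_const_sub k hm]
  linarith

/-- Bellman optimal policies exist. Among the policies of largest gain whose closed sets all contain
a suitable state `s₀`, one with the largest total bias relative to `s₀` is optimal: changing its
action in one state would otherwise increase that total. -/
theorem HasCore.exists_isBellmanOptimal {M : ArmMDP S} (hM : M.HasCore) (lam : ℝ) :
    ∃ π, M.IsBellmanOptimal lam π := by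
  have := hM.nonempty
  obtain ⟨π₀, hπ₀⟩ := Finite.exists_max fun π : S → Fin 2 => ∑ s, M.normBias lam π s
  obtain ⟨s₀, hs₀⟩ := hM π₀
  obtain ⟨π, ⟨hg, hcore⟩, hmax⟩ := Set.exists_max_image
    {π : S → Fin 2 | ∑ s, M.normBias lam π s = ∑ s, M.normBias lam π₀ s ∧
      ∀ A : Set S, A.Nonempty → M.IsClosedUnder π A → s₀ ∈ A}
    (fun π => ∑ s, (M.normBias lam π s - M.normBias lam π s₀)) (Set.toFinite _) ⟨π₀, rfl, hs₀⟩
  have hb := hM.isGainBias_normBias lam π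
  refine ⟨π, _, _, hb, ?_⟩
  by_contra! hcon
  obtain ⟨k, a, hka⟩ := hcon
  have hb' := hM.isGainBias_normBias lam (Function.update π k a)
  set π' := Function.update π k a
  have hne : ∀ s, s ≠ k → π' s = π s := fun s hs => by simp [π', hs]
  have hk : π' k = a := by simp [π']
  set d : S → ℝ := fun s => M.normBias lam π' s - M.normBias lam π s with hd
  set c : ℝ := ∑ s, M.normBias lam π' s - ∑ s, M.normBias lam π s
  have hdk : ∑ s', M.P (π' k) k s' * d s' < c + d k := by
    have h1 := hb' k
    rw [hk] at h1 ⊢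
    simp only [hd, mul_sub, Finset.sum_sub_distrib]
    linarith
  have hds : ∀ s, ∑ s', M.P (π' s) s s' * d s' ≤ c + d s := fun s => by
    rcases eq_or_ne s k with rfl | hs
    · exact hdk.le
    · have h1 := hb' s
      have h2 := hb s
      rw [hne s hs] at h1 ⊢
      simp only [hd, mul_sub, Finset.sum_sub_distrib]
      linarith
  have hc0 : c = 0 := le_antisymm (by linarith [hπ₀ π']) (M.nonneg_of_superharmonic hds)
  simp only [hc0, zero_add] at hdk hds
  obtain ⟨x, hx⟩ := Finite.exists_min d
  have hkx : d x < d k := (M.mul_le_sum_of_forall_le (π' k) k hx).trans_lt hdk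
  have hA := M.isClosedUnder_minimizers (m := d x) hx hds
  -- A `π'`-closed set avoiding `k` is `π`-closed.
  have hclosed : ∀ B : Set S, M.IsClosedUnder π' B → k ∉ B → M.IsClosedUnder π B :=
    fun B hB hkB z hz y hy => hB z hz y (by
      rwa [hne z fun hzk => hkB (hzk ▸ hz)])
  have hkA : k ∉ {z | d z = d x} := fun h => hkx.ne' h
  have hs₀A : d s₀ = d x := hcore {z | d z = d x} ⟨x, rfl⟩ (hclosed _ hA hkA)
  have hcore' : ∀ B : Set S, B.Nonempty → M.IsClosedUnder π' B → s₀ ∈ B := fun B hB hBcl =>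
    (hcore ({z | d z = d x} ∩ B) (hM.inter_nonempty (A := {z | d z = d x}) ⟨x, rfl⟩ hB hA hBcl)
      (hclosed _ (fun z hz y hy => ⟨hA z hz.1 y hy, hBcl z hz.2 y hy⟩) fun h => hkA h.1)).2
  have h1 := hmax π' ⟨by linarith, hcore'⟩
  have h2 : 0 < ∑ s, (d s - d s₀) :=
    Finset.sum_pos' (fun s _ => by rw [hs₀A]; exact sub_nonneg.2 (hx s))
      ⟨k, Finset.mem_univ k, by rw [hs₀A]; exact sub_pos.2 hkx⟩
  have h3 : ∑ s, (d s - d s₀) = ∑ s, (M.normBias lam π' s - M.normBias lam π' s₀) -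
      ∑ s, (M.normBias lam π s - M.normBias lam π s₀) := by
    rw [← Finset.sum_sub_distrib]
    exact Finset.sum_congr rfl fun s _ => by simp only [hd]; ring
  linarith

theorem HasCore.optActivationAdvantage_eq {M : ArmMDP S} (hM : M.HasCore) {lam : ℝ}
    {π : S → Fin 2} (h : M.IsBellmanOptimal lam π) (s : S) :
    M.optActivationAdvantage s lam = M.adv π s lam := by
  rw [optActivationAdvantage, hM.activationAdvantage_eq]
  exact hM.adv_eq_of_isBellmanOptimal (Classical.epsilon_spec
    (p := fun π : S → Fin 2 => M.IsBellmanOptimal lam π) ⟨π, h⟩) h s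

/-- The optimal activation advantage is continuous in the penalty: it is affine on each of the
finitely many closed sets of penalties for which a given policy is optimal. -/
theorem HasCore.continuous_optActivationAdvantage {M : ArmMDP S} (hM : M.HasCore) (s : S) :
    Continuous (M.optActivationAdvantage s) := by
  have hadv : ∀ (π : S → Fin 2) (s : S), Continuous (M.adv π s) := fun π s => by
    have : M.adv π s = fun mu => M.adv π s 0 + (mu - 0) * M.advSlope π s :=
      funext fun mu => M.adv_eq π s 0 mu
    rw [this]
    fun_prop
  refine (locallyFinite_of_finite fun π : S → Fin 2 => {lam | M.IsBellmanOptimal lam π}).continuous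
    ?_ (fun π => ?_) fun π => ?_
  · exact Set.eq_univ_of_forall fun lam => Set.mem_iUnion.2 (hM.exists_isBellmanOptimal lam)
  · simp only [hM.isBellmanOptimal_iff, GoodSign, Set.ofPred_forall, Set.ofPred_and]
    exact isClosed_iInter fun s => (isClosed_iInter fun _ =>
      isClosed_le continuous_const (hadv π s)).inter
        (isClosed_iInter fun _ => isClosed_le (hadv π s) continuous_const)
  · exact (hadv π s).continuousOn.congr fun lam h => hM.optActivationAdvantage_eq h s

end Solution

/-! ### Perturbation of the data -/

/-- Processes are topologized by the entries of their transition matrices and reward vectors. -/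
instance : TopologicalSpace (ArmMDP S) :=
  TopologicalSpace.induced (fun M => (M.P, M.r)) inferInstance

theorem continuous_data : Continuous fun M : ArmMDP S => (M.P, M.r) := continuous_induced_dom

@[fun_prop]
theorem continuous_P (a : Fin 2) (s s' : S) : Continuous fun M : ArmMDP S => M.P a s s' := by
  have := (continuous_data (S := S)).fst
  fun_prop

@[fun_prop]
theorem continuous_r (a : Fin 2) (s : S) : Continuous fun M : ArmMDP S => M.r a s := by
  have := (continuous_data (S := S)).snd
  fun_prop

theorem exists_supDist_le_of_eventually {M : ArmMDP S} {p : ArmMDP S → Prop}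
    (h : ∀ᶠ N in 𝓝 M, p N) : ∃ δ : ℝ, 0 < δ ∧ ∀ N : ArmMDP S, M.supDist N ≤ δ → p N := by
  rw [nhds_induced, eventually_comap, Metric.eventually_nhds_iff] at h
  obtain ⟨ε, hε, h⟩ := h
  refine ⟨ε / 2, half_pos hε, fun N hN => h (y := (N.P, N.r)) ?_ N rfl⟩
  obtain ⟨hP, hr⟩ := max_le_iff.1 hN
  have le2 : ∀ (f : Fin 2 → S → ℝ) (a : Fin 2) (s : S), f a s ≤ ⨆ a, ⨆ s, f a s := fun f a s =>
    (le_ciSup (Set.finite_range (f a)).bddAbove s).trans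
      (le_ciSup (Set.finite_range fun a => ⨆ s, f a s).bddAbove a)
  refine lt_of_le_of_lt ?_ (half_lt_self hε)
  have h0 := (half_pos hε).le
  rw [Prod.dist_eq, max_le_iff, dist_comm, dist_comm N.r]
  refine ⟨(dist_pi_le_iff h0).2 fun a => (dist_pi_le_iff h0).2 fun s =>
    (dist_pi_le_iff h0).2 fun s' => ?_, (dist_pi_le_iff h0).2 fun a =>
    (dist_pi_le_iff h0).2 fun s => (le2 (fun a s => |M.r a s - N.r a s|) a s).trans hr⟩
  exact (Finset.single_le_sum (f := fun s' => |M.P a s s' - N.P a s s'|)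
    (fun _ _ => abs_nonneg _) (Finset.mem_univ s')).trans
      ((le2 (fun a s => ∑ s', |M.P a s s' - N.P a s s'|) a s).trans hP)

section Perturbation

variable [DecidableEq S]

theorem HasCore.continuousAt_inv_poissonMatrix {M : ArmMDP S} (hM : M.HasCore) (π : S → Fin 2) :
    ContinuousAt (fun N : ArmMDP S => (N.poissonMatrix π)⁻¹) M := by
  have hc : Continuous fun N : ArmMDP S => N.poissonMatrix π := by
    refine continuous_matrix fun s s' => ?_
    simp only [poissonMatrix, Matrix.of_apply]
    fun_prop
  simp only [Matrix.inv_def, Ring.inverse_eq_inv']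
  exact (hc.matrix_det.continuousAt.inv₀ (hM.isUnit_det π).ne_zero).smul
    hc.matrix_adjugate.continuousAt

theorem HasCore.continuousAt_adv {M : ArmMDP S} (hM : M.HasCore) (π : S → Fin 2) (s : S)
    (lam : ℝ) : ContinuousAt (fun q : ArmMDP S × ℝ => q.1.adv π s q.2) (M, lam) := by
  have hinv : ∀ x y, ContinuousAt
      (fun q : ArmMDP S × ℝ => (q.1.poissonMatrix π)⁻¹ x y) (M, lam) := fun x y =>
    ContinuousAt.comp (f := Prod.fst) (x := (M, lam))
      (((continuous_id.matrix_elem x y).continuousAt).comp (hM.continuousAt_inv_poissonMatrix π))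
      continuousAt_fst
  simp only [adv, normBias, Matrix.mulVec, dotProduct, penReward]
  fun_prop

theorem HasCore.continuousAt_advSlope {M : ArmMDP S} (hM : M.HasCore) (π : S → Fin 2) (s : S) :
    ContinuousAt (fun N : ArmMDP S => N.advSlope π s) M := by
  have hinv : ∀ x y, ContinuousAt (fun N : ArmMDP S => (N.poissonMatrix π)⁻¹ x y) M := fun x y =>
    ((continuous_id.matrix_elem x y).continuousAt).comp (hM.continuousAt_inv_poissonMatrix π)
  simp only [advSlope, Matrix.mulVec, dotProduct]
  fun_prop

/-- The strict form of the sign condition, under which `a` is the only best choice. -/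
def StrictSign (a : Fin 2) (x : ℝ) : Prop := (a = 1 → 0 < x) ∧ (a = 0 → x < 0)

theorem StrictSign.goodSign {a : Fin 2} {x : ℝ} (h : StrictSign a x) : GoodSign a x :=
  ⟨fun ha => (h.1 ha).le, fun ha => (h.2 ha).le⟩

theorem GoodSign.strictSign {a : Fin 2} {x : ℝ} (h : GoodSign a x) (hx : x ≠ 0) :
    StrictSign a x :=
  ⟨fun ha => (h.1 ha).lt_of_ne' hx, fun ha => (h.2 ha).lt_of_ne hx⟩

/-- Two numbers with the same strict sign cannot pass from `≤ 0` to `≥ 0`. -/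
theorem StrictSign.neg_of_nonpos {a : Fin 2} {x y : ℝ} (hx : StrictSign a x)
    (hy : StrictSign a y) (h : x ≤ 0) : y < 0 := by
  rcases Fin.exists_fin_two.1 ⟨a, rfl⟩ with ha | ha
  · exact hy.2 ha
  · exact absurd (hx.1 ha) h.not_gt

theorem HasCore.eventually_strictSign {M : ArmMDP S} (hM : M.HasCore) {π : S → Fin 2} {s : S}
    {lam : ℝ} {a : Fin 2} (h : StrictSign a (M.adv π s lam)) :
    ∀ᶠ q : ArmMDP S × ℝ in 𝓝 (M, lam), StrictSign a (q.1.adv π s q.2) := by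
  have hc := hM.continuousAt_adv π s lam
  rcases Fin.exists_fin_two.1 ⟨a, rfl⟩ with ha | ha
  · filter_upwards [hc.eventually_lt_const (h.2 ha)] with q hq
    exact ⟨fun h1 => by simp [ha] at h1, fun _ => hq⟩
  · filter_upwards [hc.eventually_const_lt (h.1 ha)] with q hq
    exact ⟨fun _ => hq, fun h1 => by simp [ha] at h1⟩

/-! ### Single crossing near a penalty of the unperturbed process -/

/-- By indexability, `lam` is the Whittle index of each state whose optimal advantage vanishes at
`lam`: both actions are then optimal there, so that activity is forced below and passivity above. -/
theorem HasCore.isWhittleIndex_of_adv_eq_zero {M : ArmMDP S} (hM : M.HasCore)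
    (hidx : M.IsIndexable) {lam : ℝ} {π : S → Fin 2} (h : M.IsBellmanOptimal lam π) {k : S}
    (hk : M.adv π k lam = 0) : M.IsWhittleIndex k lam := by
  intro mu σ hσ
  constructor
  · intro hlt
    exact hidx mu lam hlt σ _ hσ (hM.isBellmanOptimal_update h hk 1)
      (by simp : Function.update π k 1 k = 1)
  · intro hlt
    by_contra h0
    have h1 : σ k = 1 := by
      rcases Fin.exists_fin_two.1 ⟨σ k, rfl⟩ with h2 | h2
      · exact absurd h2 h0
      · exact h2
    have := hidx lam mu hlt _ σ (hM.isBellmanOptimal_update h hk 0) hσ h1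
    simp at this

/-- At the Whittle index of `k`, the advantage of `k` under the policy leaving `k` passive decreases
strictly: otherwise that policy would stay optimal for slightly smaller penalties, against
indexability. -/
theorem HasCore.advSlope_neg {M : ArmMDP S} (hM : M.HasCore) (hidx : M.IsIndexable) {lam : ℝ}
    {π : S → Fin 2} (h : M.IsBellmanOptimal lam π) {k : S} (hk : M.adv π k lam = 0)
    (hstrict : ∀ s, s ≠ k → M.adv π s lam ≠ 0) : M.advSlope (Function.update π k 0) k < 0 := by
  by_contra! hsl
  have h0 := hM.isBellmanOptimal_update h hk 0
  have h1 := hM.isBellmanOptimal_update h hk 1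
  have hk0 : M.adv (Function.update π k 0) k lam = 0 := by
    rw [hM.adv_eq_of_isBellmanOptimal h0 h, hk]
  have hev : ∀ᶠ mu in 𝓝[<] lam, ∀ s, s ≠ k →
      StrictSign (Function.update π k 0 s) (M.adv (Function.update π k 0) s mu) := by
    refine eventually_all.2 fun s => eventually_imp_distrib_left.2 fun hs => ?_
    have hst : StrictSign (Function.update π k 0 s) (M.adv (Function.update π k 0) s lam) :=
      (hM.isBellmanOptimal_iff.1 h0 s).strictSign
        (by rw [hM.adv_eq_of_isBellmanOptimal h0 h]; exact hstrict s hs)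
    have hcont : Tendsto (fun mu : ℝ => (M, mu)) (𝓝[<] lam) (𝓝 (M, lam)) :=
      (Continuous.prodMk_right M).continuousAt.tendsto.mono_left nhdsWithin_le_nhds
    exact hcont.eventually (hM.eventually_strictSign hst)
  obtain ⟨mu, hmu, hlt⟩ := (hev.and self_mem_nhdsWithin).exists
  have hopt : M.IsBellmanOptimal mu (Function.update π k 0) := by
    refine hM.isBellmanOptimal_iff.2 fun s => ?_
    rcases eq_or_ne s k with rfl | hs
    · refine ⟨fun h => by simp at h, fun _ => ?_⟩
      rw [M.adv_eq _ _ lam mu, hk0, zero_add]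
      exact mul_nonpos_of_nonpos_of_nonneg (sub_nonpos.2 (le_of_lt hlt)) hsl
    · exact (hmu s hs).goodSign
  have := hidx mu lam hlt _ _ hopt h1 (by simp : Function.update π k 1 k = 1)
  simp at this

/-- Near `lam`, for processes near `M` and with its support, an optimal activation advantage which is
nonpositive is negative for all larger penalties near `lam`. If no optimal advantage of `M` vanishes
at `lam`, then all signs are locally constant. Otherwise one advantage does, that of `k` say; the
optimal policy of the perturbed process is then one of the two policies which are optimal for `M` at
`lam`, and which one is decided by the sign of a strictly decreasing affine function. -/
theorem HasCore.eventually_crossing {M : ArmMDP S} (hM : M.HasCore) (hidx : M.IsIndexable)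
    (hdistinct : ∀ (s s' : S) (x : ℝ), M.IsWhittleIndex s x → M.IsWhittleIndex s' x → s = s')
    (lam : ℝ) : ∃ U ∈ 𝓝 (M, lam), ∀ N : ArmMDP S, M.SameSupport N → ∀ x y : ℝ,
      (N, x) ∈ U → (N, y) ∈ U → x < y →
      ∀ s, N.optActivationAdvantage s x ≤ 0 → N.optActivationAdvantage s y < 0 := by
  obtain ⟨π, hπ⟩ := hM.exists_isBellmanOptimal lam
  by_cases hz : ∃ k, M.adv π k lam = 0
  · obtain ⟨k, hk⟩ := hz
    have hstrict : ∀ s, s ≠ k → M.adv π s lam ≠ 0 := fun s hs h0 =>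
      hs (hdistinct s k lam (hM.isWhittleIndex_of_adv_eq_zero hidx hπ h0)
        (hM.isWhittleIndex_of_adv_eq_zero hidx hπ hk))
    have hsl := hM.advSlope_neg hidx hπ hk hstrict
    have hev : ∀ a : Fin 2, ∀ s, ∀ᶠ q : ArmMDP S × ℝ in 𝓝 (M, lam), s ≠ k →
        StrictSign (π s) (q.1.adv (Function.update π k a) s q.2) := fun a s => by
      refine eventually_imp_distrib_left.2 fun hs => hM.eventually_strictSign ?_
      rw [hM.adv_eq_of_isBellmanOptimal (hM.isBellmanOptimal_update hπ hk a) hπ]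
      exact (hM.isBellmanOptimal_iff.1 hπ s).strictSign (hstrict s hs)
    have hslev : ∀ᶠ q : ArmMDP S × ℝ in 𝓝 (M, lam),
        q.1.advSlope (Function.update π k 0) k < 0 :=
      (continuousAt_fst (p := (M, lam))).eventually
        ((hM.continuousAt_advSlope (Function.update π k 0) k).eventually_lt_const hsl)
    refine ⟨_, inter_mem (eventually_all.2 fun a => eventually_all.2 fun s => hev a s) hslev, ?_⟩
    rintro N hN x y ⟨hx, hNsl⟩ ⟨hy, -⟩ hxy
    have hNc := hM.of_sameSupport hN
    -- Which of the two policies is optimal for `N` depends on the advantage of `k` under the first.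
    have h0 : ∀ z, (∀ a s, s ≠ k → StrictSign (π s) (N.adv (Function.update π k a) s z)) →
        N.adv (Function.update π k 0) k z ≤ 0 →
        N.IsBellmanOptimal z (Function.update π k 0) := fun z hz hle => by
      refine hNc.isBellmanOptimal_iff.2 fun s => ?_
      rcases eq_or_ne s k with rfl | hs
      · exact ⟨fun h => by simp at h, fun _ => hle⟩
      · rw [Function.update_of_ne hs]
        exact (hz 0 s hs).goodSign
    have h1 : ∀ z, (∀ a s, s ≠ k → StrictSign (π s) (N.adv (Function.update π k a) s z)) →
        0 < N.adv (Function.update π k 0) k z →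
        N.IsBellmanOptimal z (Function.update π k 1) := fun z hz hlt => by
      refine hNc.isBellmanOptimal_iff.2 fun s => ?_
      rcases eq_or_ne s k with rfl | hs
      · exact ⟨fun _ => (hNc.adv_update_one_pos hlt).le, fun h => by simp at h⟩
      · rw [Function.update_of_ne hs]
        exact (hz 1 s hs).goodSign
    have hsign : ∀ z, (∀ a s, s ≠ k → StrictSign (π s) (N.adv (Function.update π k a) s z)) →
        ∀ s, s ≠ k → StrictSign (π s) (N.optActivationAdvantage s z) := fun z hz s hs => by
      rcases le_or_gt (N.adv (Function.update π k 0) k z) 0 with hle | hlt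
      · rw [hNc.optActivationAdvantage_eq (h0 z hz hle)]
        exact hz 0 s hs
      · rw [hNc.optActivationAdvantage_eq (h1 z hz hlt)]
        exact hz 1 s hs
    intro s hsx
    rcases eq_or_ne s k with rfl | hs
    · have hle : N.adv (Function.update π s 0) s x ≤ 0 := by
        by_contra! hlt
        rw [hNc.optActivationAdvantage_eq (h1 x hx hlt)] at hsx
        exact hsx.not_gt (hNc.adv_update_one_pos hlt)
      have hneg : N.adv (Function.update π s 0) s y < 0 := by
        rw [N.adv_eq _ _ x y]
        exact add_neg_of_nonpos_of_neg hle (mul_neg_of_pos_of_neg (sub_pos.2 hxy) hNsl)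
      rwa [hNc.optActivationAdvantage_eq (h0 y hy hneg.le)]
    · exact (hsign x hx s hs).neg_of_nonpos (hsign y hy s hs) hsx
  · push Not at hz
    have hev : ∀ᶠ q : ArmMDP S × ℝ in 𝓝 (M, lam), ∀ s, StrictSign (π s) (q.1.adv π s q.2) :=
      eventually_all.2 fun s => hM.eventually_strictSign
        ((hM.isBellmanOptimal_iff.1 hπ s).strictSign (hz s))
    refine ⟨_, hev, fun N hN x y hx hy _ s hs => ?_⟩
    have hNc := hM.of_sameSupport hN
    have hopt : ∀ z, (∀ s, StrictSign (π s) (N.adv π s z)) → N.IsBellmanOptimal z π :=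
      fun z hz => hNc.isBellmanOptimal_iff.2 fun s => (hz s).goodSign
    rw [hNc.optActivationAdvantage_eq (hopt x hx)] at hs
    rw [hNc.optActivationAdvantage_eq (hopt y hy)]
    exact (hx s).neg_of_nonpos (hy s) hs

/-! ### Extreme penalties -/

/-- The policy playing `a` everywhere has advantages of slope `-1`, so that their zeros stay in a
bounded interval under perturbation. -/
theorem HasCore.eventually_abs_adv_const_lt {M : ArmMDP S} (hM : M.HasCore) :
    ∃ Λ : ℝ, ∀ᶠ N in 𝓝 M, ∀ (a : Fin 2) (s : S), |N.adv (fun _ => a) s 0| < Λ := by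
  obtain ⟨Λ, hΛ⟩ := (Set.finite_range fun p : Fin 2 × S =>
    |M.adv (fun _ => p.1) p.2 0|).bddAbove
  refine ⟨Λ + 1, eventually_all.2 fun a => eventually_all.2 fun s => ?_⟩
  have hc : ContinuousAt (fun N : ArmMDP S => |N.adv (fun _ => a) s 0|) M :=
    (ContinuousAt.comp (f := fun N : ArmMDP S => (N, (0 : ℝ)))
      (hM.continuousAt_adv (fun _ => a) s 0) (by fun_prop)).abs
  exact hc.eventually_lt_const ((hΛ ⟨(a, s), rfl⟩).trans_lt (lt_add_one Λ))

theorem HasCore.optActivationAdvantage_pos_of_le {M : ArmMDP S} (hM : M.HasCore) {Λ : ℝ}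
    (h : ∀ (a : Fin 2) (s : S), |M.adv (fun _ => a) s 0| < Λ) {lam : ℝ} (hlam : lam ≤ -Λ) (s : S) :
    0 < M.optActivationAdvantage s lam := by
  have hpos : ∀ s, 0 < M.adv (fun _ => 1) s lam := fun s => by
    rw [M.adv_eq _ _ 0, hM.advSlope_const]
    linarith [(abs_lt.1 (h 1 s)).1]
  rw [hM.optActivationAdvantage_eq (hM.isBellmanOptimal_iff.2 fun s =>
    ⟨fun _ => (hpos s).le, fun h => by simp at h⟩)]
  exact hpos s

theorem HasCore.optActivationAdvantage_neg_of_le {M : ArmMDP S} (hM : M.HasCore) {Λ : ℝ}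
    (h : ∀ (a : Fin 2) (s : S), |M.adv (fun _ => a) s 0| < Λ) {lam : ℝ} (hlam : Λ ≤ lam) (s : S) :
    M.optActivationAdvantage s lam < 0 := by
  have hneg : ∀ s, M.adv (fun _ => 0) s lam < 0 := fun s => by
    rw [M.adv_eq _ _ 0, hM.advSlope_const]
    linarith [(abs_lt.1 (h 0 s)).2]
  rw [hM.optActivationAdvantage_eq (hM.isBellmanOptimal_iff.2 fun s =>
    ⟨fun h => by simp at h, fun _ => (hneg s).le⟩)]
  exact hneg s

end Perturbation

/-! ### From local to global crossing -/

/-- A continuous function which is positive far to the left, negative far to the right, and which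
locally, around each point of an interval between, cannot leave the nonpositive reals except into
the negative ones, crosses zero exactly once. -/
theorem exists_crossing {f : ℝ → ℝ} (hf : Continuous f) {Λ : ℝ} (hl : ∀ x ≤ -Λ, 0 < f x)
    (hr : ∀ x, Λ ≤ x → f x < 0)
    (hloc : ∀ z ∈ Set.Icc (-Λ) Λ, ∃ V ∈ 𝓝 z, ∀ x ∈ V, ∀ y ∈ V, x < y → f x ≤ 0 → f y < 0) :
    ∃ x, f x = 0 ∧ (∀ y < x, 0 < f y) ∧ ∀ y, x < y → f y < 0 := by
  have hloc' : ∀ z, f z ≤ 0 → ∃ V ∈ 𝓝 z, ∀ x ∈ V, ∀ y ∈ V, x < y → f x ≤ 0 → f y < 0 := by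
    intro z hz
    by_cases hzΛ : z ∈ Set.Icc (-Λ) Λ
    · exact hloc z hzΛ
    · have h1 : -Λ < z := lt_of_not_ge fun h => hz.not_gt (hl z h)
      have h2 : Λ < z := lt_of_not_ge fun h => hzΛ ⟨h1.le, h⟩
      exact ⟨Set.Ioi Λ, Ioi_mem_nhds h2, fun _ _ y hy _ _ => hr y (le_of_lt hy)⟩
  have key : ∀ a b, a < b → f a ≤ 0 → f b < 0 := by
    intro a b hab ha
    have hsub : Set.Icc a b ⊆ {x | f x ≤ 0} := by
      refine IsClosed.Icc_subset_of_forall_mem_nhdsWithin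
        ((isClosed_le hf continuous_const).inter isClosed_Icc) ha ?_
      rintro z ⟨hz, -⟩
      obtain ⟨V, hV, h⟩ := hloc' z hz
      filter_upwards [mem_nhdsWithin_of_mem_nhds hV, self_mem_nhdsWithin] with y hy hzy
      exact (h z (mem_of_mem_nhds hV) y hy hzy hz).le
    obtain ⟨V, hV, h⟩ := hloc' b (hsub ⟨hab.le, le_rfl⟩)
    obtain ⟨x, ⟨hxV, hxa⟩, hxb⟩ := nonempty_of_mem (f := 𝓝[<] b) (inter_mem
      (mem_nhdsWithin_of_mem_nhds (inter_mem hV (Ioi_mem_nhds hab))) self_mem_nhdsWithin)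
    exact h x hxV b (mem_of_mem_nhds hV) hxb (hsub ⟨le_of_lt hxa, le_of_lt hxb⟩)
  have hΛ : -Λ < Λ := by
    by_contra! h
    exact (hl Λ h).not_gt (hr Λ le_rfl)
  obtain ⟨x, -, hx⟩ := intermediate_value_Icc' hΛ.le hf.continuousOn
    (show (0 : ℝ) ∈ Set.Icc (f Λ) (f (-Λ)) from ⟨(hr Λ le_rfl).le, (hl _ le_rfl).le⟩)
  exact ⟨x, hx, fun y hy => lt_of_not_ge fun h => (key y x hy h).ne hx,
    fun y hy => key x y hy hx.le⟩

theorem HasCore.eq_one_of_optActivationAdvantage_pos {M : ArmMDP S} (hM : M.HasCore) {lam : ℝ}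
    {π : S → Fin 2} (h : M.IsBellmanOptimal lam π) {s : S}
    (hs : 0 < M.optActivationAdvantage s lam) : π s = 1 := by
  classical
  rw [hM.optActivationAdvantage_eq h] at hs
  rcases Fin.exists_fin_two.1 ⟨π s, rfl⟩ with h0 | h0
  · exact absurd ((hM.isBellmanOptimal_iff.1 h s).2 h0) hs.not_ge
  · exact h0

theorem HasCore.eq_zero_of_optActivationAdvantage_neg {M : ArmMDP S} (hM : M.HasCore) {lam : ℝ}
    {π : S → Fin 2} (h : M.IsBellmanOptimal lam π) {s : S}
    (hs : M.optActivationAdvantage s lam < 0) : π s = 0 := by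
  classical
  rw [hM.optActivationAdvantage_eq h] at hs
  rcases Fin.exists_fin_two.1 ⟨π s, rfl⟩ with h0 | h0
  · exact h0
  · exact absurd ((hM.isBellmanOptimal_iff.1 h s).1 h0) hs.not_ge

/-- A process all of whose optimal activation advantages cross zero exactly once is indexable, and
the crossings are the Whittle indices. -/
theorem HasCore.isIndexable_of_crossing {M : ArmMDP S} (hM : M.HasCore)
    (h : ∀ s, ∃ x, M.optActivationAdvantage s x = 0 ∧
      (∀ y < x, 0 < M.optActivationAdvantage s y) ∧
      ∀ y, x < y → M.optActivationAdvantage s y < 0) :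
    M.IsIndexable ∧ ∀ s : S, ∃ x : ℝ, M.IsWhittleIndex s x ∧ M.optActivationAdvantage s x = 0 ∧
      (∀ lam : ℝ, lam < x → 0 < M.optActivationAdvantage s lam) ∧
      (∀ lam : ℝ, x < lam → M.optActivationAdvantage s lam < 0) := by
  refine ⟨fun lam lam' hlt π π' hπ hπ' s hs => ?_, fun s => ?_⟩
  · obtain ⟨x, -, hl, hr⟩ := h s
    refine hM.eq_one_of_optActivationAdvantage_pos hπ (hl lam (hlt.trans_le ?_))
    by_contra! hx
    have h0 := hM.eq_zero_of_optActivationAdvantage_neg hπ' (hr lam' hx)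
    have h1 : π' s = 1 := hs
    simp [h0] at h1
  · obtain ⟨x, h0, hl, hr⟩ := h s
    exact ⟨x, fun lam π hπ => ⟨fun hlt => hM.eq_one_of_optActivationAdvantage_pos hπ (hl lam hlt),
      fun hlt => hM.eq_zero_of_optActivationAdvantage_neg hπ (hr lam hlt)⟩, h0, hl, hr⟩

end ArmMDP

open ArmMDP in
theorem mainTheorem2 {S : Type*} [Fintype S] (M : ArmMDP S)
    (hM : M.IsUnichain) (hidx : M.IsIndexable)
    (hdistinct : ∀ (s s' : S) (x : ℝ),
      M.IsWhittleIndex s x → M.IsWhittleIndex s' x → s = s') :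
    ∃ δ : ℝ, 0 < δ ∧ ∀ N : ArmMDP S, M.SameSupport N → M.supDist N ≤ δ →
      N.IsIndexable ∧
      ∀ s : S, ∃ x : ℝ, N.IsWhittleIndex s x ∧ N.optActivationAdvantage s x = 0 ∧
        (∀ lam : ℝ, lam < x → 0 < N.optActivationAdvantage s lam) ∧
        (∀ lam : ℝ, x < lam → N.optActivationAdvantage s lam < 0) := by
  classical
  have hMc := hM.hasCore
  obtain ⟨Λ, hΛ⟩ := hMc.eventually_abs_adv_const_lt
  -- By compactness of `[-Λ, Λ]`, one neighbourhood of `M` serves all penalties in it.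
  have hcross : ∀ᶠ N in 𝓝 M, ∀ z ∈ Set.Icc (-Λ) Λ, M.SameSupport N → ∃ V ∈ 𝓝 z,
      ∀ x ∈ V, ∀ y ∈ V, x < y →
      ∀ s, N.optActivationAdvantage s x ≤ 0 → N.optActivationAdvantage s y < 0 := by
    refine isCompact_Icc.eventually_forall_of_forall_eventually fun z _ => ?_
    obtain ⟨U, hU, h⟩ := hMc.eventually_crossing hidx hdistinct z
    filter_upwards [eventually_mem_nhds_iff.2 hU] with q hq hN
    exact ⟨{x | (q.1, x) ∈ U}, (Continuous.prodMk_right q.1).continuousAt hq,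
      fun x hx y hy hxy s => h q.1 hN x y hx hy hxy s⟩
  obtain ⟨δ, hδ, h⟩ := exists_supDist_le_of_eventually (hΛ.and hcross)
  refine ⟨δ, hδ, fun N hN hdist => ?_⟩
  obtain ⟨hNΛ, hNcross⟩ := h N hdist
  have hNc := hMc.of_sameSupport hN
  refine hNc.isIndexable_of_crossing fun s =>
    exists_crossing (hNc.continuous_optActivationAdvantage s)
      (fun x hx => hNc.optActivationAdvantage_pos_of_le hNΛ hx s)
      (fun x hx => hNc.optActivationAdvantage_neg_of_le hNΛ hx s) fun z hz => ?_
  obtain ⟨V, hV, hcr⟩ := hNcross z hz hN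
  exact ⟨V, hV, fun x hx y hy hxy => hcr x hx y hy hxy s⟩
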